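/- All rings are commutative with $1$. For a ring extension $A\subseteq B$ and $b\in B$, let $\mathrm{id}_A(b)\in\{1,2,\dots,\infty\}$ be the least $n\ge 1$ such that $b$ is a root of a monic polynomial of degree $n$ with coefficients in $A$, and let $\mathrm{d}_A(B)=\sup\{\mathrm{id}_A(b)\mid b\in B\}$ be the integral degree of $B$ over $A$. Let $\mu_A(B)$ be the minimal number of generators of $B$ as an $A$-module. The polynomial $T^3-T^2-2T-8$ is irreducible over $\mathbb{Q}$. Let $L=\mathbb{Q}(\gamma_1)$, where $\gamma_1$ is a root of this polynomial, let $B$ be the ring of integers of $L$, and let $\gamma_2=(\gamma_1^2+\gamma_1)/2$. Then: (a) $\gamma_1,\gamma_2\in B$, and $B$ is a free $\mathbb{Z}$-module with basis $\{1,\gamma_1,\gamma_2\}$. (b) $\mathrm{d}_{\mathbb{Q}}(L)=\mathrm{d}_{\mathbb{Z}}(B)=\mu_{\mathbb{Z}}(B)=3$, and there is no $b\in B$ with $B=\mathbb{Z}[b]$. Let $A=\mathbb{Z}+2\mathbb{Z}\gamma_1+2\mathbb{Z}\gamma_2=\{a+b\gamma_1+c\gamma_2\mid a,b,c\in\mathbb{Z},\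 b\equiv c\equiv 0 \pmod 2\}$. Then: (c) $A$ is a subring of $B$, it is a free $\mathbb{Z}$-module and an integral domain with field of fractions $L$; moreover $A$ is noetherian of Krull dimension $1$ and not integrally closed. (d) $B$ is the integral closure of $A$ in $L$, it is finite (hence integral) over $A$, and $\mathrm{d}_A(B)=2$, $\mu_A(B)=3$. (e) Let $\alpha$, in any extension field of $L$, be a root of $T^2+\gamma_1T+(1+\gamma_2)\in B[T]$, and let $C=B[\alpha]$. Then $B\subseteq C$ is integral, $\mathrm{d}_B(C)=2$ and $\mathrm{d}_A(C)=6$; in particular $\mathrm{d}_A(C)>\mathrm{d}_A(B)\,\mathrm{d}_B(C)$. Consequently, the integral degree is not sub-multiplicative with respect to $A\subseteq B$: it is not true that $\mathrm{d}_A(C')\le \mathrm{d}_A(B)\,\mathrm{d}_B(C')$ for every integral extension of integral domains $B\subseteq C'$. So sub-multiplicativity can fail for a one-dimensional noetherian domain with finite integral closure. -/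

import Mathlib

open Polynomial NumberField

universe u v w

section IntegralDegree

/-- The integral degree of an element `b` of an `A`-algebra `B`: the least `n ≥ 1` such that `b`
is a root of a monic polynomial of degree `n` over `A` (and `⊤` if there is none). -/
noncomputable def elementIntegralDegree (A : Type*) {B : Type*} [CommRing A] [CommRing B]
    [Algebra A B] (b : B) : ℕ∞ :=
  ⨅ (p : A[X]) (_ : p.Monic ∧ 1 ≤ p.natDegree ∧ aeval b p = 0), (p.natDegree : ℕ∞)

/-- The integral degree of `B` over `A`: the supremum (possibly infinite) of the integral degrees
of the elements of `B` over `A`. -/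
noncomputable def integralDegree (A B : Type*) [CommRing A] [CommRing B] [Algebra A B] : ℕ∞ :=
  ⨆ b : B, elementIntegralDegree A b

/-- The integral degree is sub-multiplicative with respect to the extension `A ⊆ B` if
`d_A(C) ≤ d_A(B) * d_B(C)` for every integral extension of domains `B ⊆ C`. -/
def IntegralDegreeSubmultiplicative (A : Type u) (B : Type v) [CommRing A] [CommRing B]
    [Algebra A B] : Prop :=
  ∀ (C : Type w) [CommRing C] [IsDomain C] [Algebra A C] [Algebra B C] [IsScalarTower A B C],
    Function.Injective (algebraMap B C) → Algebra.IsIntegral B C →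
      integralDegree A C ≤ integralDegree A B * integralDegree B C

end IntegralDegree

/-!
The whole argument rests on the multiplication table of the basis `1, g₁, g₂`, which is recorded in
`IsDedekindBasis`, and on its consequence that `2` splits completely: reducing coordinates modulo
`2` gives three ring homomorphisms `R → 𝔽₂` (`IsDedekindBasis.residue`), which together identify
`R / 2R` with `𝔽₂³`. The order `A = ℤ + 2R` consists of the elements on which they agree.

* `R` is not monogenic, because no element of `𝔽₂³` has three distinct coordinates
  (`IsDedekindBasis.adjoin_singleton_ne_top`), and `R` needs three generators over `A`, because
  `𝔽₂³` does over `𝔽₂` (`IsDedekindBasis.three_le_spanRank`).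
* Every element of `𝔽₂³` is idempotent, so `b² - b ∈ A` for all `b`, and `b` is a root of the
  polynomial `T² - T - (b² - b)` over `A`: the integral degree of `R` over `A` is `2`.
* The quadratic `f = T² + g₁T + (1 + g₂)` reduces to `(T + 1)²`, `T² + T + 1` and `T²` at the three
  residue maps. The second reduction is irreducible, so `f` is irreducible, and it is the minimal
  polynomial of its root `α` over the integrally closed domain `R`. A monic polynomial over `A` with
  root `α` is then divisible by `f` over `R`; its three reductions coincide, so this common
  reduction is divisible by the three pairwise coprime reductions of `f` and has degree at least
  `6` (`IsDedekindBasis.six_le_natDegree_of_aeval_eq_zero`). Conversely `R[α]` has rank `6` over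
  `ℤ`, so the Cayley–Hamilton theorem bounds its integral degree by `6`.

It remains to see that `1, γ, (γ² + γ) / 2` is a basis of the ring of integers
(`DedekindField.exists_int_basis`). The Gram matrix of its trace form has determinant `-503`, which
is squarefree; `DedekindField.exists_int_of_trace_form` turns this into an explicit
computation showing that the coordinates of an algebraic integer are integers.
-/

/-! ### Integral degree -/

section IntegralDegreeLemmas

variable {A B : Type*} [CommRing A] [CommRing B] [Algebra A B]

theorem elementIntegralDegree_le {b : B} {p : A[X]} (hp : p.Monic) (h1 : 1 ≤ p.natDegree)
    (h0 : aeval b p = 0) : elementIntegralDegree A b ≤ p.natDegree :=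
  iInf₂_le p ⟨hp, h1, h0⟩

theorem le_elementIntegralDegree_iff {b : B} {n : ℕ∞} :
    n ≤ elementIntegralDegree A b ↔
      ∀ p : A[X], p.Monic → 1 ≤ p.natDegree → aeval b p = 0 → n ≤ p.natDegree := by
  simp only [elementIntegralDegree, le_iInf_iff, and_imp]

theorem le_integralDegree {b : B} {n : ℕ∞} (h : n ≤ elementIntegralDegree A b) :
    n ≤ integralDegree A B :=
  h.trans (le_iSup _ b)

theorem integralDegree_le_iff {n : ℕ∞} :
    integralDegree A B ≤ n ↔ ∀ b : B, elementIntegralDegree A b ≤ n :=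
  iSup_le_iff

theorem two_le_elementIntegralDegree {b : B} (hb : b ∉ Set.range (algebraMap A B)) :
    2 ≤ elementIntegralDegree A b := by
  refine le_elementIntegralDegree_iff.2 fun p hp h1 h0 ↦ ?_
  by_contra! hlt
  have hdeg : p.natDegree = 1 := by
    have : p.natDegree < 2 := by exact_mod_cast hlt
    omega
  rw [hp.eq_X_add_C hdeg, map_add, aeval_X, aeval_C] at h0
  exact hb ⟨-p.coeff 0, by rw [map_neg]; exact (eq_neg_of_add_eq_zero_left h0).symm⟩

/-- By the Cayley–Hamilton theorem, a finite free algebra has integral degree at most its rank. -/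
theorem integralDegree_le_finrank [Nontrivial A] [Module.Finite A B] [Module.Free A B]
    (h : 1 ≤ Module.finrank A B) : integralDegree A B ≤ Module.finrank A B := by
  refine integralDegree_le_iff.2 fun b ↦ ?_
  obtain ⟨p, hp, hdeg, h0⟩ :=
    LinearMap.exists_monic_and_natDegree_eq_and_aeval_eq_zero A (Algebra.lmul A B b)
  rw [← Module.finrank_eq_spanFinrank_of_free] at hdeg
  rw [← hdeg]
  refine elementIntegralDegree_le hp (hdeg ▸ h) ?_
  rw [aeval_algHom_apply] at h0
  simpa using congrArg (fun f : Module.End A B ↦ f 1) h0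

theorem integralDegree_le_of_tower (R : Type*) [CommRing R] [Algebra R A] [Algebra R B]
    [IsScalarTower R A B] [Nontrivial A] : integralDegree A B ≤ integralDegree R B := by
  refine integralDegree_le_iff.2 fun b ↦ le_integralDegree (b := b) ?_
  refine le_elementIntegralDegree_iff.2 fun p hp h1 h0 ↦ ?_
  have hdeg := hp.natDegree_map (algebraMap R A)
  rw [← hdeg]
  exact elementIntegralDegree_le (hp.map _) (hdeg.symm ▸ h1) (by rwa [aeval_map_algebraMap])

end IntegralDegreeLemmas

/-! ### The arithmetic of a ring with Dedekind's multiplication table -/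

/-- The basis `e` of `R` over `ℤ` has the form `1, g₁, g₂` with Dedekind's multiplication table
`g₁² = -g₁ + 2g₂`, `g₁g₂ = 4 + 2g₂`, `g₂² = 6 + 2g₁ + 3g₂`. -/
structure IsDedekindBasis {R : Type*} [CommRing R] (e : Module.Basis (Fin 3) ℤ R) : Prop where
  zero : e 0 = 1
  one_mul_one : e 1 * e 1 = 2 * e 2 - e 1
  one_mul_two : e 1 * e 2 = 2 * e 2 + 4
  two_mul_two : e 2 * e 2 = 3 * e 2 + 2 * e 1 + 6

namespace IsDedekindBasis

variable {R : Type*} [CommRing R] {e : Module.Basis (Fin 3) ℤ R}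

theorem eq_sum_repr (h : IsDedekindBasis e) (x : R) :
    x = (e.repr x 0 : R) + (e.repr x 1 : R) * e 1 + (e.repr x 2 : R) * e 2 := by
  conv_lhs => rw [← e.sum_repr x]
  simp [Fin.sum_univ_three, h.zero]

theorem repr_eq (h : IsDedekindBasis e) (a b c : ℤ) :
    ⇑(e.repr ((a : R) + (b : R) * e 1 + (c : R) * e 2)) = ![a, b, c] := by
  have : (a : R) + (b : R) * e 1 + (c : R) * e 2 = ∑ i, (![a, b, c] i) • e i := by
    simp [Fin.sum_univ_three, h.zero]
  rw [this, e.repr_sum_self]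

theorem repr_one (h : IsDedekindBasis e) : ⇑(e.repr 1) = ![1, 0, 0] := by
  simpa using h.repr_eq 1 0 0

theorem repr_mul (h : IsDedekindBasis e) (x y : R) :
    ⇑(e.repr (x * y)) =
      ![e.repr x 0 * e.repr y 0 + 4 * (e.repr x 1 * e.repr y 2 + e.repr x 2 * e.repr y 1) +
          6 * (e.repr x 2 * e.repr y 2),
        e.repr x 0 * e.repr y 1 + e.repr x 1 * e.repr y 0 - e.repr x 1 * e.repr y 1 +
          2 * (e.repr x 2 * e.repr y 2),
        e.repr x 0 * e.repr y 2 + e.repr x 2 * e.repr y 0 + 2 * (e.repr x 1 * e.repr y 1) +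
          2 * (e.repr x 1 * e.repr y 2 + e.repr x 2 * e.repr y 1) +
          3 * (e.repr x 2 * e.repr y 2)] := by
  rw [← h.repr_eq]
  congr 2
  conv_lhs => rw [h.eq_sum_repr x, h.eq_sum_repr y]
  push_cast
  linear_combination (e.repr x 1 * e.repr y 1 : R) * h.one_mul_one +
    (e.repr x 1 * e.repr y 2 + e.repr x 2 * e.repr y 1 : R) * h.one_mul_two +
    (e.repr x 2 * e.repr y 2 : R) * h.two_mul_two

/-- The three ring homomorphisms `R → 𝔽₂` that send `(g₁, g₂)` to `(0, 0)`, `(1, 0)`, `(0, 1)`.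
They exhibit `2` as totally split in `R`: together they induce `R / 2R ≃ 𝔽₂³`. -/
noncomputable def residue (h : IsDedekindBasis e) (i : Fin 3) : R →+* ZMod 2 where
  toFun x := e.repr x 0 + e.repr x 1 * ![0, 1, 0] i + e.repr x 2 * ![0, 0, 1] i
  map_one' := by simp [h.repr_one]
  map_zero' := by simp
  map_add' x y := by simp; ring
  map_mul' x y := by
    rw [h.repr_mul]
    have h2 : (2 : ZMod 2) = 0 := rfl
    generalize e.repr x = a, e.repr y = b
    fin_cases i <;> simp
    · linear_combination (2 * (a 1 * b 2 + a 2 * b 1) + 3 * (a 2 * b 2) : ZMod 2) * h2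
    · linear_combination (2 * (a 1 * b 2 + a 2 * b 1) + 4 * (a 2 * b 2) - a 1 * b 1 : ZMod 2) * h2
    · linear_combination (3 * (a 1 * b 2 + a 2 * b 1) + 4 * (a 2 * b 2) + a 1 * b 1 : ZMod 2) * h2

theorem residue_apply (h : IsDedekindBasis e) (i : Fin 3) (x : R) :
    h.residue i x = e.repr x 0 + e.repr x 1 * ![0, 1, 0] i + e.repr x 2 * ![0, 0, 1] i := rfl

theorem residue_one (h : IsDedekindBasis e) (i : Fin 3) : h.residue i (e 1) = ![0, 1, 0] i := by
  simp [residue_apply]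

theorem residue_two (h : IsDedekindBasis e) (i : Fin 3) : h.residue i (e 2) = ![0, 0, 1] i := by
  simp [residue_apply]

/-- Over `𝔽₂` no element separates the three residue maps, whence `R` is not monogenic. -/
theorem adjoin_singleton_ne_top (h : IsDedekindBasis e) (b : R) : Algebra.adjoin ℤ {b} ≠ ⊤ := by
  intro hb
  have key (i j : Fin 3) (hij : h.residue i b = h.residue j b) : i = j := by
    have hext : (h.residue i).toIntAlgHom = (h.residue j).toIntAlgHom :=
      AlgHom.ext_of_adjoin_eq_top hb fun x hx ↦ by
        rw [Set.mem_singleton_iff.1 hx]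
        exact hij
    have h1 := DFunLike.congr_fun hext (e 1)
    have h2 := DFunLike.congr_fun hext (e 2)
    simp only [RingHom.toIntAlgHom_apply, residue_one, residue_two] at h1 h2
    revert h1 h2
    clear * -
    decide +revert
  have hinj : Function.Injective fun i ↦ h.residue i b := fun i j hij ↦ key i j hij
  have := Fintype.card_le_of_injective _ hinj
  simp [ZMod.card] at this

theorem residue_surjective (h : IsDedekindBasis e) :
    Function.Surjective fun (x : R) (i : Fin 3) ↦ h.residue i x := by
  intro y
  obtain ⟨a, ha⟩ := ZMod.intCast_surjective (y 0)
  obtain ⟨b, hb⟩ := ZMod.intCast_surjective (y 1)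
  obtain ⟨c, hc⟩ := ZMod.intCast_surjective (y 2)
  refine ⟨(a : R) + ((b - a : ℤ) : R) * e 1 + ((c - a : ℤ) : R) * e 2, funext fun i ↦ ?_⟩
  simp only [residue_apply, h.repr_eq]
  fin_cases i <;> simp [ha, hb, hc]

/-- If the residue maps agree on a subring `S`, then `R` needs three generators over `S`, because
`𝔽₂³` needs three generators over `𝔽₂`. -/
theorem three_le_spanRank (h : IsDedekindBasis e) {S : Type*} [CommRing S] [Algebra S R]
    (hS : ∀ i s, h.residue i (algebraMap S R s) = h.residue 0 (algebraMap S R s)) :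
    3 ≤ (⊤ : Submodule S R).spanRank := by
  let σ : S →+* ZMod 2 := (h.residue 0).comp (algebraMap S R)
  have hσ : RingHomSurjective σ := ⟨ZMod.ringHom_surjective σ⟩
  let f : R →ₛₗ[σ] (Fin 3 → ZMod 2) :=
    { toFun x i := h.residue i x
      map_add' x y := by ext; simp
      map_smul' s x := by
        ext i
        rw [Algebra.smul_def, map_mul, hS i s]
        rfl }
  have hle := Submodule.lift_spanRank_map_le f ⊤
  rw [Submodule.map_top, LinearMap.range_eq_top.2 h.residue_surjective,
    ← Submodule.rank_eq_spanRank_of_free] at hle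
  simpa using hle

theorem spanRank_int (e : Module.Basis (Fin 3) ℤ R) : (⊤ : Submodule ℤ R).spanRank = 3 := by
  have := Module.Free.of_basis e
  rw [← Submodule.rank_eq_spanRank_of_free, rank_eq_card_basis e]
  simp

/-! ### The order `A = ℤ + 2R` -/

/-- The order `ℤ + 2R` of elements whose coordinates at `g₁` and `g₂` are even. -/
def order (h : IsDedekindBasis e) : Subalgebra ℤ R where
  carrier := {x | Even (e.repr x 1) ∧ Even (e.repr x 2)}
  mul_mem' {x y} hx hy := by
    obtain ⟨⟨a, ha⟩, b, hb⟩ := hx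
    obtain ⟨⟨c, hc⟩, d, hd⟩ := hy
    simp only [Set.mem_ofPred_eq, h.repr_mul, ha, hb, hc, hd]
    simp [parity_simps]
  add_mem' hx hy := by simpa using ⟨hx.1.add hy.1, hx.2.add hy.2⟩
  algebraMap_mem' n := by
    have := h.repr_eq n 0 0
    simp only [Int.cast_zero, zero_mul, add_zero] at this
    simp [this]

theorem mem_order (h : IsDedekindBasis e) {x : R} :
    x ∈ h.order ↔ Even (e.repr x 1) ∧ Even (e.repr x 2) := Iff.rfl

theorem mem_order_iff_exists (h : IsDedekindBasis e) {x : R} :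
    x ∈ h.order ↔ ∃ a b c : ℤ, Even b ∧ Even c ∧ x = (a : R) + (b : R) * e 1 + (c : R) * e 2 := by
  refine ⟨fun hx ↦ ⟨_, _, _, hx.1, hx.2, h.eq_sum_repr x⟩, ?_⟩
  rintro ⟨a, b, c, hb, hc, rfl⟩
  rw [mem_order, h.repr_eq]
  exact ⟨hb, hc⟩

theorem toSubmodule_order (h : IsDedekindBasis e) :
    Subalgebra.toSubmodule h.order = Submodule.span ℤ {1, 2 * e 1, 2 * e 2} := by
  ext x
  rw [Subalgebra.mem_toSubmodule, mem_order_iff_exists, Submodule.mem_span_triple]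
  constructor
  · rintro ⟨a, b, c, ⟨b, rfl⟩, ⟨c, rfl⟩, rfl⟩
    exact ⟨a, b, c, by simp; ring⟩
  · rintro ⟨a, b, c, rfl⟩
    exact ⟨a, b + b, c + c, ⟨b, rfl⟩, ⟨c, rfl⟩, by simp; ring⟩

theorem residue_of_mem_order (h : IsDedekindBasis e) {x : R} (hx : x ∈ h.order) (i : Fin 3) :
    h.residue i x = h.residue 0 x := by
  obtain ⟨⟨b, hb⟩, c, hc⟩ := hx
  simp [residue_apply, hb, hc, CharTwo.add_self_eq_zero]

theorem two_mul_mem_order (h : IsDedekindBasis e) (x : R) : 2 * x ∈ h.order := by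
  simp [mem_order, two_mul]

/-- Modulo `2` every element is idempotent, being so in `𝔽₂³`. -/
theorem sq_sub_self_mem_order (h : IsDedekindBasis e) (x : R) : x ^ 2 - x ∈ h.order := by
  rw [mem_order, sq, map_sub, Finsupp.sub_apply, Finsupp.sub_apply, h.repr_mul]
  simp only [Matrix.cons_val]
  generalize e.repr x 0 = a, e.repr x 1 = b, e.repr x 2 = c
  simp only [parity_simps]
  tauto

theorem basis_one_notMem_order (h : IsDedekindBasis e) : e 1 ∉ h.order := by
  simp [mem_order]

theorem integralDegree_order (h : IsDedekindBasis e) : integralDegree h.order R = 2 := by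
  have := e.repr.toEquiv.nontrivial
  refine le_antisymm (integralDegree_le_iff.2 fun b ↦ ?_)
    (le_integralDegree (b := e 1) (two_le_elementIntegralDegree ?_))
  · let a : h.order := ⟨b ^ 2 - b, h.sq_sub_self_mem_order b⟩
    have hdeg : (X ^ 2 - X - C a : h.order[X]).natDegree = 2 := by compute_degree!
    have := elementIntegralDegree_le (b := b) (p := X ^ 2 - X - C a) (by monicity!)
      (by omega) (by simp [a])
    rwa [hdeg] at this
  · rintro ⟨x, hx⟩
    exact h.basis_one_notMem_order (hx ▸ x.2)

theorem spanRank_order (h : IsDedekindBasis e) : (⊤ : Submodule h.order R).spanRank = 3 := by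
  refine le_antisymm ?_ (h.three_le_spanRank fun i s ↦ h.residue_of_mem_order s.2 i)
  rw [← spanRank_int e]
  exact Submodule.le_spanRank_restrictScalars (R := ℤ) (⊤ : Submodule h.order R)

end IsDedekindBasis

namespace IsDedekindBasis

variable {R : Type*} [CommRing R] {e : Module.Basis (Fin 3) ℤ R}

theorem free_order (h : IsDedekindBasis e) : Module.Free ℤ h.order := by
  have := Module.Free.of_basis e
  have := Module.Finite.of_basis e
  exact inferInstanceAs (Module.Free ℤ (Subalgebra.toSubmodule h.order))

theorem finite_order (h : IsDedekindBasis e) : Module.Finite ℤ h.order := by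
  have := Module.Finite.of_basis e
  exact inferInstanceAs (Module.Finite ℤ (Subalgebra.toSubmodule h.order))

theorem isNoetherianRing_order (h : IsDedekindBasis e) : IsNoetherianRing h.order := by
  have := h.finite_order
  exact IsNoetherianRing.of_finite ℤ h.order

theorem module_finite_over_order (h : IsDedekindBasis e) : Module.Finite h.order R := by
  have := Module.Finite.of_basis e
  exact .of_restrictScalars_finite ℤ h.order R

theorem ringKrullDim_order [IsDomain R] [CharZero R] (h : IsDedekindBasis e) :
    ringKrullDim h.order = 1 := by
  have := h.finite_order
  have := Ring.DimensionLEOne.of_isIntegral ℤ h.order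
  refine eq_of_le_of_not_lt ?_ fun hlt ↦ ?_
  · rw [← Nat.cast_one, ← Ring.krullDimLE_iff]
    infer_instance
  · have hle : ringKrullDim h.order ≤ 0 := Order.le_of_lt_succ hlt
    rw [← Nat.cast_zero, ← Ring.krullDimLE_iff] at hle
    have hfield : IsField h.order := Ring.KrullDimLE.isField_of_isDomain
    exact Int.not_isField ((Algebra.IsIntegral.isField_iff_isField
      (algebraMap ℤ h.order).injective_int).2 hfield)

theorem isFractionRing_order [IsDomain R] [CharZero R] (h : IsDedekindBasis e)
    (K : Type*) [Field K] [Algebra R K] [IsFractionRing R K] : IsFractionRing h.order K := by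
  have hinj : Function.Injective (algebraMap h.order K) :=
    (IsFractionRing.injective R K).comp Subtype.val_injective
  have := (faithfulSMul_iff_algebraMap_injective h.order K).2 hinj
  have h2 : algebraMap R K 2 ≠ 0 := by
    rw [Ne, map_eq_zero_iff _ (IsFractionRing.injective R K)]
    exact two_ne_zero
  refine IsFractionRing.of_field h.order K fun z ↦ ?_
  -- A fraction `x / y` over `R` equals `2x / 2y`, which is a fraction over the order.
  obtain ⟨x, y, -, rfl⟩ := IsFractionRing.div_surjective (A := R) z
  refine ⟨⟨2 * x, h.two_mul_mem_order x⟩, ⟨2 * y, h.two_mul_mem_order y⟩, ?_⟩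
  change _ = algebraMap R K (2 * x) / algebraMap R K (2 * y)
  rw [map_mul, map_mul, mul_div_mul_left _ _ h2]

theorem not_isIntegrallyClosed_order [IsDomain R] [CharZero R] (h : IsDedekindBasis e) :
    ¬ IsIntegrallyClosed h.order := by
  intro hic
  have := h.isFractionRing_order (FractionRing R)
  have := h.module_finite_over_order
  have hint : IsIntegral h.order (algebraMap R (FractionRing R) (e 1)) :=
    (Algebra.IsIntegral.isIntegral (e 1)).algebraMap
  obtain ⟨y, hy⟩ := IsIntegrallyClosed.isIntegral_iff.1 hint
  have : (y : R) = e 1 := IsFractionRing.injective R (FractionRing R) hy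
  exact h.basis_one_notMem_order (this ▸ y.2)

/-! ### The quadratic extension -/

/-- The polynomial `T² + g₁T + (1 + g₂)`. -/
noncomputable def quadratic (e : Module.Basis (Fin 3) ℤ R) : R[X] :=
  X ^ 2 + C (e 1) * X + C (1 + e 2)

theorem quadratic_monic (e : Module.Basis (Fin 3) ℤ R) : (quadratic e).Monic := by
  unfold quadratic
  monicity!

theorem natDegree_quadratic (e : Module.Basis (Fin 3) ℤ R) [Nontrivial R] :
    (quadratic e).natDegree = 2 := by
  unfold quadratic
  compute_degree!

theorem map_quadratic (h : IsDedekindBasis e) (i : Fin 3) :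
    (quadratic e).map (h.residue i) =
      X ^ 2 + C (![0, 1, 0] i) * X + C (1 + ![0, 0, 1] i) := by
  simp [quadratic, residue_one, residue_two]

theorem irreducible_map_quadratic_one (h : IsDedekindBasis e) :
    Irreducible ((quadratic e).map (h.residue 1)) := by
  have hdeg : ((quadratic e).map (h.residue 1)).natDegree = 2 := by
    rw [map_quadratic]
    compute_degree!
  rw [irreducible_iff_roots_eq_zero_of_degree_le_three (by omega) (by omega)]
  refine Multiset.eq_zero_of_forall_notMem fun x hx ↦ ?_
  have hroot := isRoot_of_mem_roots hx
  rw [map_quadratic, IsRoot.def] at hroot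
  have hne : ∀ y : ZMod 2, y ^ 2 + y + 1 ≠ 0 := by decide
  exact hne x (by simpa using hroot)

/-- The quadratic is irreducible because its reduction at the second residue map, `T² + T + 1`,
is. -/
theorem irreducible_quadratic [IsDomain R] (h : IsDedekindBasis e) :
    Irreducible (quadratic e) :=
  (quadratic_monic e).irreducible_of_irreducible_map (h.residue 1) _
    h.irreducible_map_quadratic_one

/-- The reductions `(T + 1)²`, `T² + T + 1` and `T²` of the quadratic at the three residue maps are
pairwise coprime, so a polynomial over `𝔽₂` divisible by all three has degree at least `6`. -/
theorem six_le_natDegree_of_map_dvd (h : IsDedekindBasis e) {q : (ZMod 2)[X]} (hq : q ≠ 0)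
    (hdvd : ∀ i, (quadratic e).map (h.residue i) ∣ q) : 6 ≤ q.natDegree := by
  have h2 : (2 : (ZMod 2)[X]) = 0 := CharTwo.two_eq_zero
  have d0 : X ^ 2 + 1 ∣ q := by simpa [map_quadratic] using hdvd 0
  have d1 : X ^ 2 + X + 1 ∣ q := by simpa [map_quadratic] using hdvd 1
  have d2 : X ^ 2 ∣ q := by
    simpa [map_quadratic, CharTwo.add_self_eq_zero] using hdvd 2
  have c01 : IsCoprime (X ^ 2 + 1 : (ZMod 2)[X]) (X ^ 2 + X + 1) :=
    ⟨X + 1, X, by linear_combination (X ^ 3 + X ^ 2 + X) * h2⟩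
  have c02 : IsCoprime (X ^ 2 + 1 : (ZMod 2)[X]) (X ^ 2) :=
    ⟨1, 1, by linear_combination X ^ 2 * h2⟩
  have c12 : IsCoprime (X ^ 2 + X + 1 : (ZMod 2)[X]) (X ^ 2) :=
    ⟨X + 1, X, by linear_combination (X ^ 3 + X ^ 2 + X) * h2⟩
  have hprod := (c02.mul_left c12).mul_dvd (c01.mul_dvd d0 d1) d2
  have hdeg : ((X ^ 2 + 1) * (X ^ 2 + X + 1) * X ^ 2 : (ZMod 2)[X]).natDegree = 6 := by
    compute_degree!
  exact hdeg ▸ natDegree_le_of_dvd hprod hq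

section Extension

theorem isIntegral_of_aeval_quadratic {M : Type*} [CommRing M] [Algebra R M] {α : M}
    (hα : aeval α (quadratic e) = 0) : IsIntegral R α :=
  ⟨_, quadratic_monic e, hα⟩

theorem isIntegral_adjoin {M : Type*} [CommRing M] [Algebra R M] {α : M}
    (hα : aeval α (quadratic e) = 0) : Algebra.IsIntegral R (Algebra.adjoin R {α}) :=
  Algebra.IsIntegral.adjoin fun _ hx ↦
    Set.mem_singleton_iff.1 hx ▸ isIntegral_of_aeval_quadratic hα

variable [IsDomain R] [IsIntegrallyClosed R] {M : Type*} [CommRing M] [IsDomain M] [Algebra R M]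
  [Module.IsTorsionFree R M] {α : M}

theorem minpoly_eq_quadratic (h : IsDedekindBasis e) (hα : aeval α (quadratic e) = 0) :
    minpoly R α = quadratic e := by
  have hint := isIntegral_of_aeval_quadratic hα
  refine eq_of_monic_of_associated (minpoly.monic hint) (quadratic_monic e) ?_
  exact (minpoly.irreducible hint).associated_of_dvd h.irreducible_quadratic
    (minpoly.isIntegrallyClosed_dvd hint hα)

/-- Since `R` is integrally closed, `R[α]` is free on the powers of `α` below the degree of the
minimal polynomial. -/
theorem finrank_adjoin (h : IsDedekindBasis e) (hα : aeval α (quadratic e) = 0) :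
    Module.finrank R (Algebra.adjoin R {α}) = 2 := by
  rw [(Algebra.adjoin.powerBasis' (isIntegral_of_aeval_quadratic hα)).finrank,
    Algebra.adjoin.powerBasis'_dim, h.minpoly_eq_quadratic hα, natDegree_quadratic]

theorem integralDegree_adjoin (h : IsDedekindBasis e) (hα : aeval α (quadratic e) = 0) :
    integralDegree R (Algebra.adjoin R {α}) = 2 := by
  have hint := isIntegral_of_aeval_quadratic hα
  have := (Algebra.adjoin.powerBasis' hint).finite
  have := Module.Free.of_basis (Algebra.adjoin.powerBasis' hint).basis
  have hrank := h.finrank_adjoin hα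
  refine le_antisymm ?_ (le_integralDegree
    (b := ⟨α, Algebra.self_mem_adjoin_singleton R α⟩) ?_)
  · exact (integralDegree_le_finrank (by omega)).trans (by rw [hrank]; rfl)
  · refine le_elementIntegralDegree_iff.2 fun p hp _ h0 ↦ ?_
    have h0' : aeval α p = 0 := 
      (Subalgebra.aeval_coe _ _ _).trans (congrArg Subtype.val h0)
    have hle := natDegree_le_of_dvd (minpoly.isIntegrallyClosed_dvd hint h0') hp.ne_zero
    rw [h.minpoly_eq_quadratic hα, natDegree_quadratic] at hle
    exact_mod_cast hle

/-- The integral degree over `A = ℤ + 2R` of a root `α` of the quadratic is at least `6`: a monic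
polynomial over `A` with root `α` is divisible over `R` by the quadratic, and it has the same
reduction at all three residue maps, so that reduction is divisible by all the reductions of the
quadratic. -/
theorem six_le_natDegree_of_aeval_eq_zero (h : IsDedekindBasis e)
    (hα : aeval α (quadratic e) = 0) {p : h.order[X]} (hp : p.Monic)
    (h0 : aeval α (p.map (algebraMap h.order R)) = 0) : 6 ≤ p.natDegree := by
  have hdvd := minpoly.isIntegrallyClosed_dvd (isIntegral_of_aeval_quadratic hα) h0
  rw [h.minpoly_eq_quadratic hα] at hdvd
  have hmap (i : Fin 3) : (p.map (algebraMap h.order R)).map (h.residue i) =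
      (p.map (algebraMap h.order R)).map (h.residue 0) := by
    ext n
    simp only [coeff_map]
    exact h.residue_of_mem_order (p.coeff n).2 i
  have hmonic := (hp.map (algebraMap h.order R)).map (h.residue 0)
  refine (h.six_le_natDegree_of_map_dvd hmonic.ne_zero fun i ↦ ?_).trans
    ((natDegree_map_le).trans natDegree_map_le)
  exact hmap i ▸ Polynomial.map_dvd (h.residue i) hdvd

/-- The upper bound holds already over `ℤ`, since `R[α]` is free of rank `3 * 2`. -/
theorem integralDegree_order_adjoin (h : IsDedekindBasis e) (hα : aeval α (quadratic e) = 0) :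
    integralDegree h.order (Algebra.adjoin R {α}) = 6 := by
  have hint := isIntegral_of_aeval_quadratic hα
  have := (Algebra.adjoin.powerBasis' hint).finite
  have := Module.Free.of_basis (Algebra.adjoin.powerBasis' hint).basis
  have := Module.Finite.of_basis e
  have := Module.Free.of_basis e
  have := Module.Finite.trans (R := ℤ) R (Algebra.adjoin R {α})
  have := Module.Free.trans (R := ℤ) (S := R) (M := Algebra.adjoin R {α})
  have hrank : Module.finrank ℤ (Algebra.adjoin R {α}) = 6 := by
    rw [← Module.finrank_mul_finrank ℤ R, h.finrank_adjoin hα, Module.finrank_eq_card_basis e]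
    rfl
  refine le_antisymm ?_ (le_integralDegree
    (b := ⟨α, Algebra.self_mem_adjoin_singleton R α⟩) ?_)
  · refine (integralDegree_le_of_tower ℤ).trans ((integralDegree_le_finrank (by omega)).trans ?_)
    rw [hrank]
    rfl
  · refine le_elementIntegralDegree_iff.2 fun p hp _ h0 ↦ ?_
    have := h.six_le_natDegree_of_aeval_eq_zero hα hp (by
      rw [← aeval_map_algebraMap R] at h0
      exact (Subalgebra.aeval_coe _ _ _).trans (congrArg Subtype.val h0))
    exact_mod_cast this

theorem integralDegree_mul_lt (h : IsDedekindBasis e) (hα : aeval α (quadratic e) = 0) :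
    integralDegree h.order R * integralDegree R (Algebra.adjoin R {α}) <
      integralDegree h.order (Algebra.adjoin R {α}) := by
  rw [h.integralDegree_order, h.integralDegree_adjoin hα, h.integralDegree_order_adjoin hα]
  decide

end Extension

end IsDedekindBasis

/-! ### Dedekind's cubic field -/

namespace DedekindField

/-- Dedekind's polynomial `T³ - T² - 2T - 8` has no root modulo `3`. -/
theorem irreducible_cubic : Irreducible (X ^ 3 - X ^ 2 - 2 * X - 8 : ℚ[X]) := by
  have hZ : (X ^ 3 - X ^ 2 - 2 * X - 8 : ℤ[X]).Monic := by monicity!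
  have h3 : Irreducible ((X ^ 3 - X ^ 2 - 2 * X - 8 : ℤ[X]).map (Int.castRingHom (ZMod 3))) := by
    have hmap : (X ^ 3 - X ^ 2 - 2 * X - 8 : ℤ[X]).map (Int.castRingHom (ZMod 3)) =
        X ^ 3 - X ^ 2 - 2 * X - 8 := by simp
    have hdeg : (X ^ 3 - X ^ 2 - 2 * X - 8 : (ZMod 3)[X]).natDegree = 3 := by compute_degree!
    rw [hmap, irreducible_iff_roots_eq_zero_of_degree_le_three (by omega) (by omega)]
    refine Multiset.eq_zero_of_forall_notMem fun x hx ↦ ?_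
    have hroot := isRoot_of_mem_roots hx
    have hne : ∀ y : ZMod 3, y ^ 3 - y ^ 2 - 2 * y - 8 ≠ 0 := by decide
    exact hne x (by simpa [IsRoot.def] using hroot)
  have hQ := hZ.irreducible_iff_irreducible_map_fraction_map (K := ℚ).1
    (hZ.irreducible_of_irreducible_map _ _ h3)
  simpa using hQ

variable {L : Type*} [Field L] {γ : L}

theorem cubic_relation [CharZero L] (hroot : aeval γ (X ^ 3 - X ^ 2 - 2 * X - 8 : ℚ[X]) = 0) :
    γ ^ 3 = γ ^ 2 + 2 * γ + 8 := by
  simp only [map_sub, map_mul, map_pow, aeval_X, map_ofNat] at hroot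
  linear_combination hroot

theorem isIntegral_root (h : γ ^ 3 = γ ^ 2 + 2 * γ + 8) : IsIntegral ℤ γ :=
  ⟨X ^ 3 - X ^ 2 - 2 * X - 8, by monicity!, by
    simp
    linear_combination h⟩

variable [CharZero L]

/-- The characteristic polynomial of `(γ² + γ) / 2` is `T³ - 3T² - 10T - 8`. -/
theorem isIntegral_half (h : γ ^ 3 = γ ^ 2 + 2 * γ + 8) : IsIntegral ℤ ((γ ^ 2 + γ) / 2) :=
  ⟨X ^ 3 - 3 * X ^ 2 - 10 * X - 8, by monicity!, by
    simp
    linear_combination (γ ^ 3 / 8 + γ ^ 2 / 2 + 3 * γ / 8 + 1) * h⟩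

theorem minpoly_root (hroot : aeval γ (X ^ 3 - X ^ 2 - 2 * X - 8 : ℚ[X]) = 0) :
    minpoly ℚ γ = X ^ 3 - X ^ 2 - 2 * X - 8 :=
  (minpoly.eq_of_irreducible_of_monic irreducible_cubic hroot (by monicity!)).symm

theorem natDegree_minpoly_root (hroot : aeval γ (X ^ 3 - X ^ 2 - 2 * X - 8 : ℚ[X]) = 0) :
    (minpoly ℚ γ).natDegree = 3 := by
  rw [minpoly_root hroot]
  compute_degree!

theorem finrank_eq_three (hroot : aeval γ (X ^ 3 - X ^ 2 - 2 * X - 8 : ℚ[X]) = 0)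
    (hgen : IntermediateField.adjoin ℚ {γ} = ⊤) : Module.finrank ℚ L = 3 := by
  have hint : IsIntegral ℚ γ := (isIntegral_root (cubic_relation hroot)).tower_top
  rw [← natDegree_minpoly_root hroot, ← IntermediateField.adjoin.finrank hint, hgen,
    IntermediateField.finrank_top']

theorem linearIndependent_triple
    (hroot : aeval γ (X ^ 3 - X ^ 2 - 2 * X - 8 : ℚ[X]) = 0) :
    LinearIndependent ℚ ![1, γ, (γ ^ 2 + γ) / 2] := by
  rw [Fintype.linearIndependent_iff]
  intro c hc
  have hq : C (c 2 / 2) * X ^ 2 + C (c 1 + c 2 / 2) * X + C (c 0) = 0 := by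
    by_contra hne
    have hle := natDegree_le_natDegree (minpoly.degree_le_of_ne_zero ℚ γ hne (by
      simp [Fin.sum_univ_three, Algebra.smul_def] at hc ⊢
      linear_combination hc))
    rw [natDegree_minpoly_root hroot] at hle
    exact absurd (hle.trans natDegree_quadratic_le) (by norm_num)
  have h0 := congrArg (coeff · 0) hq
  have h1 := congrArg (coeff · 1) hq
  have h2 := congrArg (coeff · 2) hq
  simp [coeff_X, coeff_C] at h0 h1 h2
  intro i
  fin_cases i
  · exact h0
  · simpa [h2] using h1
  · exact h2

theorem exists_rat_basis (hroot : aeval γ (X ^ 3 - X ^ 2 - 2 * X - 8 : ℚ[X]) = 0)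
    (hgen : IntermediateField.adjoin ℚ {γ} = ⊤) :
    ∃ b : Module.Basis (Fin 3) ℚ L, ⇑b = ![1, γ, (γ ^ 2 + γ) / 2] :=
  ⟨basisOfLinearIndependentOfCardEqFinrank (linearIndependent_triple hroot)
    (by simp [finrank_eq_three hroot hgen]), coe_basisOfLinearIndependentOfCardEqFinrank _ _⟩

section Trace

variable {b : Module.Basis (Fin 3) ℚ L}

theorem repr_rat_basis (hb : ⇑b = ![1, γ, (γ ^ 2 + γ) / 2]) (x y z : ℚ) :
    ⇑(b.repr (x + y * γ + z * ((γ ^ 2 + γ) / 2))) = ![x, y, z] := by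
  have : (x + y * γ + z * ((γ ^ 2 + γ) / 2) : L) = ∑ i, (![x, y, z] i) • b i := by
    simp [Fin.sum_univ_three, hb, Algebra.smul_def]
  rw [this, b.repr_sum_self]

theorem trace_eq_sum (x : L) :
    Algebra.trace ℚ L x = b.repr (x * b 0) 0 + b.repr (x * b 1) 1 + b.repr (x * b 2) 2 := by
  rw [Algebra.trace_eq_matrix_trace b, Matrix.trace, Fin.sum_univ_three]
  simp only [Matrix.diag_apply, Algebra.leftMulMatrix_eq_repr_mul]

/-- The basis elements `1`, `g₁`, `g₂` have traces `3`, `1`, `3`. -/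
theorem trace_eq (h : γ ^ 3 = γ ^ 2 + 2 * γ + 8) (hb : ⇑b = ![1, γ, (γ ^ 2 + γ) / 2])
    (x y z : ℚ) :
    Algebra.trace ℚ L (x + y * γ + z * ((γ ^ 2 + γ) / 2)) = 3 * x + y + 3 * z := by
  have e0 : (x + y * γ + z * ((γ ^ 2 + γ) / 2) : L) * b 0 =
      (x : ℚ) + (y : ℚ) * γ + (z : ℚ) * ((γ ^ 2 + γ) / 2) := by
    simp [hb]
  have e1 : (x + y * γ + z * ((γ ^ 2 + γ) / 2) : L) * b 1 =
      (4 * z : ℚ) + (x - y : ℚ) * γ + (2 * y + 2 * z : ℚ) * ((γ ^ 2 + γ) / 2) := by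
    simp [hb]
    linear_combination (z / 2 : L) * h
  have e2 : (x + y * γ + z * ((γ ^ 2 + γ) / 2) : L) * b 2 =
      (4 * y + 6 * z : ℚ) + (2 * z : ℚ) * γ +
        (x + 2 * y + 3 * z : ℚ) * ((γ ^ 2 + γ) / 2) := by
    simp [hb]
    linear_combination (y / 2 + z / 4 * γ + 3 * z / 4 : L) * h
  rw [trace_eq_sum (b := b), e0, e1, e2, repr_rat_basis hb, repr_rat_basis hb, repr_rat_basis hb]
  simp
  ring

end Trace

/-- The Gram matrix of the trace form has determinant `-503`, and its radical modulo `503` is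
spanned by `(108, 176, 1)`. So if `t₀, t₁, t₂` are integers, then `(x, y, z)` is an integral vector
plus `N / 503` times this generator; the last hypothesis, on the value of the trace form at
`(x, y, z)`, then forces `503 ∣ N`. -/
theorem exists_int_of_trace_form {x y z : ℚ} {t₀ t₁ t₂ s : ℤ} (h0 : 3 * x + y + 3 * z = t₀)
    (h1 : x + 5 * y + 18 * z = t₁) (h2 : 3 * x + 18 * y + 29 * z = t₂)
    (hs : x * t₀ + y * t₁ + z * t₂ = s) :
    ∃ a b c : ℤ, x = a ∧ y = b ∧ z = c := by
  -- Cramer's rule for the Gram matrix, with the numerators reduced modulo `503`.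
  set N : ℤ := -3 * t₀ + 51 * t₁ - 14 * t₂ with hN
  have hx : 503 * x = (108 * N + 503 * (t₀ - 11 * t₁ + 3 * t₂) : ℤ) := by
    push_cast [hN]
    linear_combination 179 * h0 - 25 * h1 - 3 * h2
  have hy : 503 * y = (176 * N + 503 * (t₀ - 18 * t₁ + 5 * t₂) : ℤ) := by
    push_cast [hN]
    linear_combination -25 * h0 - 78 * h1 + 51 * h2
  have hz : 503 * z = (N : ℤ) := by
    push_cast [hN]
    linear_combination -3 * h0 + 51 * h1 - 14 * h2
  have hform : (503 * s : ℤ) = (108 * N + 503 * (t₀ - 11 * t₁ + 3 * t₂)) * t₀ +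
      (176 * N + 503 * (t₀ - 18 * t₁ + 5 * t₂)) * t₁ + N * t₂ := by
    have : (503 * s : ℚ) = 503 * x * t₀ + 503 * y * t₁ + 503 * z * t₂ := by
      linear_combination -503 * hs
    rw [hx, hy, hz] at this
    exact_mod_cast this
  have hprime : Prime (503 : ℤ) := Int.prime_iff_natAbs_prime.2 (by norm_num)
  -- Modulo `503` the form takes the value `-36 N²`.
  have hdvd : (503 : ℤ) ∣ 36 * N ^ 2 :=
    ⟨(t₀ - 11 * t₁ + 3 * t₂) * t₀ + (t₀ - 18 * t₁ + 5 * t₂) * t₁ + N * (4 * t₁ - t₂) - s, by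
      linear_combination hform + 36 * N * hN⟩
  obtain ⟨c, hc⟩ : (503 : ℤ) ∣ N :=
    hprime.dvd_of_dvd_pow ((hprime.dvd_or_dvd hdvd).resolve_left (by norm_num))
  rw [hc] at hx hy hz
  refine ⟨108 * c + (t₀ - 11 * t₁ + 3 * t₂), 176 * c + (t₀ - 18 * t₁ + 5 * t₂), c, ?_, ?_, ?_⟩
  · push_cast at hx ⊢
    linear_combination hx / 503
  · push_cast at hy ⊢
    linear_combination hy / 503
  · push_cast at hz ⊢
    linear_combination hz / 503

/-- An algebraic integer `x` has integral coordinates at `1, γ, (γ² + γ) / 2`: the traces of its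
products with the basis and of `x²` are integers, and `exists_int_of_trace_form` applies. -/
theorem exists_int_coordinates (hroot : aeval γ (X ^ 3 - X ^ 2 - 2 * X - 8 : ℚ[X]) = 0)
    (hgen : IntermediateField.adjoin ℚ {γ} = ⊤) {x : L} (hx : IsIntegral ℤ x) :
    ∃ a b c : ℤ, x = a + b * γ + c * ((γ ^ 2 + γ) / 2) := by
  have h := cubic_relation hroot
  obtain ⟨b, hb⟩ := exists_rat_basis hroot hgen
  have : FiniteDimensional ℚ L := .of_basis b
  have hint {y : L} (hy : IsIntegral ℤ y) : ∃ n : ℤ, Algebra.trace ℚ L y = n := by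
    obtain ⟨n, hn⟩ := IsIntegrallyClosed.isIntegral_iff.1 (Algebra.isIntegral_trace (L := ℚ) hy)
    exact ⟨n, by simp [← hn]⟩
  obtain ⟨p, q, r, rfl⟩ : ∃ p q r : ℚ, x = p + q * γ + r * ((γ ^ 2 + γ) / 2) := by
    refine ⟨b.repr x 0, b.repr x 1, b.repr x 2, ?_⟩
    conv_lhs => rw [← b.sum_repr x]
    simp [Fin.sum_univ_three, hb, Algebra.smul_def]
  obtain ⟨t₀, h0⟩ := hint hx
  obtain ⟨t₁, h1⟩ := hint (hx.mul (isIntegral_root h))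
  obtain ⟨t₂, h2⟩ := hint (hx.mul (isIntegral_half h))
  obtain ⟨s, hs⟩ := hint (hx.mul hx)
  have e1 : (p + q * γ + r * ((γ ^ 2 + γ) / 2) : L) * γ =
      (4 * r : ℚ) + (p - q : ℚ) * γ + (2 * q + 2 * r : ℚ) * ((γ ^ 2 + γ) / 2) := by
    push_cast
    linear_combination (r / 2 : L) * h
  have e2 : (p + q * γ + r * ((γ ^ 2 + γ) / 2) : L) * ((γ ^ 2 + γ) / 2) =
      (4 * q + 6 * r : ℚ) + (2 * r : ℚ) * γ +
        (p + 2 * q + 3 * r : ℚ) * ((γ ^ 2 + γ) / 2) := by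
    push_cast
    linear_combination (q / 2 + r / 4 * γ + 3 * r / 4 : L) * h
  have e3 : (p + q * γ + r * ((γ ^ 2 + γ) / 2) : L) * (p + q * γ + r * ((γ ^ 2 + γ) / 2)) =
      (p * p + 8 * q * r + 6 * r * r : ℚ) + (2 * p * q - q * q + 2 * r * r : ℚ) * γ +
        (2 * p * r + 2 * q * q + 4 * q * r + 3 * r * r : ℚ) * ((γ ^ 2 + γ) / 2) := by
    push_cast
    linear_combination (q * r + r ^ 2 / 4 * γ + 3 * r ^ 2 / 4 : L) * h
  rw [trace_eq h hb] at h0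
  rw [e1, trace_eq h hb] at h1
  rw [e2, trace_eq h hb] at h2
  rw [e3, trace_eq h hb] at hs
  obtain ⟨k, m, n, rfl, rfl, rfl⟩ := exists_int_of_trace_form h0 (by linear_combination h1)
    (by linear_combination h2) (s := s) (by
      rw [← h0, ← h1, ← h2, ← hs]
      ring)
  exact ⟨k, m, n, by simp⟩

end DedekindField

/-! ### The ring of integers of the cubic field -/

namespace DedekindField

variable {L : Type*} [Field L] [CharZero L] {γ : L}

theorem exists_int_basis (hroot : aeval γ (X ^ 3 - X ^ 2 - 2 * X - 8 : ℚ[X]) = 0)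
    (hgen : IntermediateField.adjoin ℚ {γ} = ⊤) {g₁ g₂ : 𝓞 L} (h1 : (g₁ : L) = γ)
    (h2 : (g₂ : L) = (γ ^ 2 + γ) / 2) :
    ∃ e : Module.Basis (Fin 3) ℤ (𝓞 L), ⇑e = ![1, g₁, g₂] := by
  have hcoe : ⇑((algebraMap (𝓞 L) L).toIntAlgHom.toLinearMap) ∘ ![1, g₁, g₂] =
      ![1, γ, (γ ^ 2 + γ) / 2] := by
    ext i
    fin_cases i
    · exact map_one (algebraMap (𝓞 L) L)
    · exact h1
    · exact h2
  have hli : LinearIndependent ℤ ![1, g₁, g₂] := by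
    refine .of_comp (algebraMap (𝓞 L) L).toIntAlgHom.toLinearMap ?_
    rw [hcoe]
    refine (linearIndependent_triple hroot).restrict_scalars fun a b hab ↦ ?_
    simpa using hab
  refine ⟨.mk hli fun x _ ↦ ?_, Module.Basis.coe_mk _ _⟩
  obtain ⟨a, b, c, hx⟩ := exists_int_coordinates hroot hgen x.isIntegral_coe
  have hsum : x = ∑ i, (![a, b, c] i) • ![1, g₁, g₂] i := by
    ext
    simp [Fin.sum_univ_three, hx, h1, h2]
  rw [hsum]
  exact Submodule.sum_mem _ fun i _ ↦ Submodule.smul_mem _ _ (Submodule.subset_span ⟨i, rfl⟩)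

theorem isDedekindBasis (h : γ ^ 3 = γ ^ 2 + 2 * γ + 8) {g₁ g₂ : 𝓞 L} (h1 : (g₁ : L) = γ)
    (h2 : (g₂ : L) = (γ ^ 2 + γ) / 2) {e : Module.Basis (Fin 3) ℤ (𝓞 L)}
    (he : ⇑e = ![1, g₁, g₂]) : IsDedekindBasis e := by
  have hnum (n : ℕ) [n.AtLeastTwo] :
      algebraMap (𝓞 L) L (OfNat.ofNat n) = OfNat.ofNat n := map_ofNat _ n
  refine ⟨by simp [he], ?_, ?_, ?_⟩
  · ext
    simp [he, h1, h2, hnum]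
    ring
  · ext
    simp [he, h1, h2, hnum]
    linear_combination h / 2
  · ext
    simp [he, h1, h2, hnum]
    linear_combination (γ / 4 + 3 / 4) * h

theorem integralDegree_rat (hroot : aeval γ (X ^ 3 - X ^ 2 - 2 * X - 8 : ℚ[X]) = 0)
    (hgen : IntermediateField.adjoin ℚ {γ} = ⊤) : integralDegree ℚ L = 3 := by
  have hrank := finrank_eq_three hroot hgen
  have : FiniteDimensional ℚ L := .of_finrank_pos (by omega)
  refine le_antisymm ?_ (le_integralDegree (b := γ) (le_elementIntegralDegree_iff.2 ?_))
  · exact (integralDegree_le_finrank (by omega)).trans (by rw [hrank]; rfl)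
  · intro p hp _ h0
    have hle := natDegree_le_of_dvd (minpoly.dvd ℚ γ h0) hp.ne_zero
    rw [natDegree_minpoly_root hroot] at hle
    exact_mod_cast hle

theorem integralDegree_int (hroot : aeval γ (X ^ 3 - X ^ 2 - 2 * X - 8 : ℚ[X]) = 0)
    {g : 𝓞 L} (hg : (g : L) = γ) (e : Module.Basis (Fin 3) ℤ (𝓞 L)) :
    integralDegree ℤ (𝓞 L) = 3 := by
  have := Module.Free.of_basis e
  have := Module.Finite.of_basis e
  have hrank := Module.finrank_eq_card_basis e
  rw [Fintype.card_fin] at hrank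
  refine le_antisymm ?_ (le_integralDegree (b := g) (le_elementIntegralDegree_iff.2 ?_))
  · exact (integralDegree_le_finrank (by omega)).trans (by rw [hrank]; rfl)
  · intro p hp _ h0
    have h0' : aeval γ (p.map (algebraMap ℤ ℚ)) = 0 := by
      rw [aeval_map_algebraMap, ← hg, aeval_algebraMap_apply, h0, map_zero]
    have hle := natDegree_le_of_dvd (minpoly.dvd ℚ γ h0') (hp.map _).ne_zero
    rw [natDegree_minpoly_root hroot, hp.natDegree_map] at hle
    exact_mod_cast hle

end DedekindField

open DedekindField in
theorem mainTheorem11 {L : Type u} [Field L] [CharZero L] (γ₁ : L)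
    (hroot : aeval γ₁ (X ^ 3 - X ^ 2 - 2 * X - 8 : ℚ[X]) = 0)
    (hgen : IntermediateField.adjoin ℚ {γ₁} = ⊤) :
    Irreducible (X ^ 3 - X ^ 2 - 2 * X - 8 : ℚ[X]) ∧
    ∃ g₁ g₂ : 𝓞 L, (g₁ : L) = γ₁ ∧ (g₂ : L) = (γ₁ ^ 2 + γ₁) / 2 ∧
      -- (a) and (b): the ring of integers
      (∃ e : Module.Basis (Fin 3) ℤ (𝓞 L), ⇑e = ![1, g₁, g₂]) ∧
      integralDegree ℚ L = 3 ∧ integralDegree ℤ (𝓞 L) = 3 ∧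
      (⊤ : Submodule ℤ (𝓞 L)).spanRank = 3 ∧
      (¬ ∃ b : 𝓞 L, Algebra.adjoin ℤ {b} = ⊤) ∧
      -- the order `A` and its two descriptions
      ∃ A : Subalgebra ℤ (𝓞 L),
        Subalgebra.toSubmodule A = Submodule.span ℤ {1, 2 * g₁, 2 * g₂} ∧
        (∀ x : 𝓞 L, x ∈ A ↔
          ∃ a b c : ℤ, Even b ∧ Even c ∧ x = (a : 𝓞 L) + (b : 𝓞 L) * g₁ + (c : 𝓞 L) * g₂) ∧
        -- (c)
        Module.Free ℤ A ∧ IsDomain A ∧ IsFractionRing A L ∧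
        IsNoetherianRing A ∧ ringKrullDim A = 1 ∧ ¬ IsIntegrallyClosed A ∧
        -- (d)
        IsIntegralClosure (𝓞 L) A L ∧ Module.Finite A (𝓞 L) ∧ Algebra.IsIntegral A (𝓞 L) ∧
        integralDegree A (𝓞 L) = 2 ∧ (⊤ : Submodule A (𝓞 L)).spanRank = 3 ∧
        -- (e): the extension `C = (𝓞 L)[α]`, for a root `α` in any extension field of `L`
        (∀ (M : Type v) [Field M] [Algebra L M] (α : M),
          aeval α (X ^ 2 + C g₁ * X + C (1 + g₂) : (𝓞 L)[X]) = 0 →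
            Algebra.IsIntegral (𝓞 L) (Algebra.adjoin (𝓞 L) {α}) ∧
            integralDegree (𝓞 L) (Algebra.adjoin (𝓞 L) {α}) = 2 ∧
            integralDegree A (Algebra.adjoin (𝓞 L) {α}) = 6 ∧
            integralDegree A (𝓞 L) * integralDegree (𝓞 L) (Algebra.adjoin (𝓞 L) {α}) <
              integralDegree A (Algebra.adjoin (𝓞 L) {α})) ∧
        ¬ IntegralDegreeSubmultiplicative.{u, u, u} A (𝓞 L) := by
  have h := cubic_relation hroot
  let g₁ : 𝓞 L := ⟨γ₁, isIntegral_root h⟩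
  let g₂ : 𝓞 L := ⟨(γ₁ ^ 2 + γ₁) / 2, isIntegral_half h⟩
  have h1 : (g₁ : L) = γ₁ := rfl
  have h2 : (g₂ : L) = (γ₁ ^ 2 + γ₁) / 2 := rfl
  obtain ⟨e, he⟩ := exists_int_basis hroot hgen h1 h2
  have hb := isDedekindBasis h h1 h2 he
  have e1 : e 1 = g₁ := by simp [he]
  have e2 : e 2 = g₂ := by simp [he]
  clear_value g₁ g₂
  have : NumberField L :=
    { to_finiteDimensional := .of_finrank_pos (by rw [finrank_eq_three hroot hgen]; simp) }
  have := hb.finite_order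
  have := hb.module_finite_over_order
  have hquad : X ^ 2 + C g₁ * X + C (1 + g₂) = IsDedekindBasis.quadratic e := by
    rw [IsDedekindBasis.quadratic, e1, e2]
  refine ⟨irreducible_cubic, g₁, g₂, h1, h2, ⟨e, he⟩, integralDegree_rat hroot hgen,
    integralDegree_int hroot h1 e, IsDedekindBasis.spanRank_int e,
    fun ⟨b, hb'⟩ ↦ hb.adjoin_singleton_ne_top b hb', hb.order, ?_, fun x ↦ ?_, hb.free_order,
    inferInstance, hb.isFractionRing_order L, hb.isNoetherianRing_order, hb.ringKrullDim_order,
    hb.not_isIntegrallyClosed_order, IsIntegralClosure.tower_top (R := ℤ), inferInstance,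
    inferInstance, hb.integralDegree_order, hb.spanRank_order, fun M _ _ α hα ↦ ?_,
    fun hsub ↦ ?_⟩
  · rw [hb.toSubmodule_order, e1, e2]
  · rw [hb.mem_order_iff_exists, e1, e2]
  · rw [hquad] at hα
    have : Module.IsTorsionFree (𝓞 L) M := .trans_faithfulSMul (𝓞 L) L M
    exact ⟨IsDedekindBasis.isIntegral_adjoin hα, hb.integralDegree_adjoin hα,
      hb.integralDegree_order_adjoin hα, hb.integralDegree_mul_lt hα⟩
  · -- Any root of the quadratic in an algebraic closure of `L` violates sub-multiplicativity.
    have hdeg : ((IsDedekindBasis.quadratic e).map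
        (algebraMap (𝓞 L) (AlgebraicClosure L))).degree ≠ 0 := by
      rw [(IsDedekindBasis.quadratic_monic e).degree_map,
        degree_eq_natDegree (IsDedekindBasis.quadratic_monic e).ne_zero,
        IsDedekindBasis.natDegree_quadratic]
      decide
    obtain ⟨α, hα⟩ := IsAlgClosed.exists_root _ hdeg
    rw [IsRoot.def, eval_map_algebraMap] at hα
    have : Module.IsTorsionFree (𝓞 L) (AlgebraicClosure L) :=
      .trans_faithfulSMul (𝓞 L) L (AlgebraicClosure L)
    refine (hb.integralDegree_mul_lt hα).not_ge
      (hsub _ ?_ (IsDedekindBasis.isIntegral_adjoin hα))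
    exact FaithfulSMul.algebraMap_injective _ _
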